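/- Let $\mathbb{K}$ be $\mathbb{R}$ or $\mathbb{C}$, let $\Omega$ be a Boolean algebra, and let $\mathcal{A}$ be a Banach category over $\mathbb{K}$, that is, a category enriched in Banach spaces and linear contractions (for instance a Banach $2$-space, i.e. a cocomplete Banach category). A precosheaf is a functor $\mu\colon\Omega\to\mathcal{A}$ all of whose maps $\mu_{F,E}\colon\mu(F)\to\mu(E)$, $F\le E$, have norm at most $1$. Let $\mu$ be a finitely additive cosheaf: for every finite partition $E=E_1\vee\dots\vee E_n$ into pairwise disjoint elements (some of which may be $0$), the maps $\mu_{E_k,E}\colon\mu(E_k)\to\mu(E)$ form a coproduct in the enriched sense, i.e. for every object $Y$ the map $t\mapsto(t\mu_{E_k,E})_k$ is an isometric isomorphism from $\mathcal{A}(\mu(E),Y)$ onto $\prod_k\mathcal{A}(\mu(E_k),Y)$ with the supremum norm. For $F\le E$ let $p_{E,F}\colon\mu(E)\to\mu(F)$ be the unique arrow with $p_{E,F}\,\mu_{F,E}=\mathrm{id}$ and $p_{E,F}\,\mu_{E\setminus F,E}=0$, and put $P_E=\mu_{E,1}\,p_{1,E}\in\operatorname{End}(\mu(1))$, where $1$ is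 the top element of $\Omega$. Let $L_\infty(\Omega)$ be the completion of the algebra of simple elements (the vector space spanned by symbols $\chi(E)$, $E\in\Omega$, modulo $\chi(E\vee F)=\chi(E)+\chi(F)$ for disjoint $E,F$, with product $\chi(E)\chi(F)=\chi(E\wedge F)$) for the norm $\|\sum_n k_n\chi(E_n)\|=\max_n|k_n|$, for pairwise disjoint non-zero $E_n$. Then: 1. $E\mapsto P_E$ is a spectral measure on $\mu(1)$: $P_{E\vee F}=P_E+P_F$ for disjoint $E,F$, $P_{E\wedge F}=P_EP_F$ for all $E,F$, and $P_1=\mathrm{id}$; it is bounded, with $\|P_E\|\le 1$. 2. There is a unique continuous unital algebra morphism $\Phi\colon L_\infty(\Omega)\to\operatorname{End}(\mu(1))$ with $\Phi(\chi(E))=P_E$ for all $E\in\Omega$, and it is a contraction. 3. $\Phi$ is an isometry if and only if $\mu$ is non-degenerate, i.e. $\mu(E)$ is a zero object only for $E=0$. -/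

import Mathlib

open CategoryTheory

/-! ## Banach categories

A Banach category is a category enriched in the monoidal category of Banach spaces over `𝕜` and
linear contractions, with the projective tensor product. Since contractions out of a projective
tensor product are the bilinear maps of norm at most one, this means: the morphisms `X ⟶ Y` form
a Banach space, composition is bilinear with `‖f ≫ g‖ ≤ ‖f‖ * ‖g‖`, and `‖𝟙 X‖ ≤ 1`. -/

/-- The part of the structure of a Banach category that does not mention the scalars: complete
normed groups of morphisms, and biadditive contractive composition. -/
class BanachHoms (C : Type*) [Category C] where
  homGroup : ∀ X Y : C, NormedAddCommGroup (X ⟶ Y)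
  homComplete : ∀ X Y : C, CompleteSpace (X ⟶ Y)
  add_comp : ∀ {X Y Z : C} (f f' : X ⟶ Y) (g : Y ⟶ Z), (f + f') ≫ g = f ≫ g + f' ≫ g
  comp_add : ∀ {X Y Z : C} (f : X ⟶ Y) (g g' : Y ⟶ Z), f ≫ (g + g') = f ≫ g + f ≫ g'
  norm_comp_le : ∀ {X Y Z : C} (f : X ⟶ Y) (g : Y ⟶ Z), ‖f ≫ g‖ ≤ ‖f‖ * ‖g‖
  norm_id_le : ∀ X : C, ‖𝟙 X‖ ≤ 1

attribute [reducible, instance] BanachHoms.homGroup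
attribute [instance] BanachHoms.homComplete

/-- A Banach category over `𝕜`: the morphism spaces are Banach spaces over `𝕜` and composition is
bilinear and contractive. -/
class BanachCategory (𝕜 : Type*) [RCLike 𝕜] (C : Type*) [Category C] [BanachHoms C] where
  homSpace : ∀ X Y : C, NormedSpace 𝕜 (X ⟶ Y)
  smul_comp : ∀ {X Y Z : C} (r : 𝕜) (f : X ⟶ Y) (g : Y ⟶ Z), (r • f) ≫ g = r • (f ≫ g)
  comp_smul : ∀ {X Y Z : C} (f : X ⟶ Y) (r : 𝕜) (g : Y ⟶ Z), f ≫ (r • g) = r • (f ≫ g)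

attribute [reducible, instance] BanachCategory.homSpace

instance BanachHoms.instPreadditive (C : Type*) [Category C] [BanachHoms C] : Preadditive C where
  homGroup _ _ := inferInstance
  add_comp _ _ _ := BanachHoms.add_comp
  comp_add _ _ _ := BanachHoms.comp_add

instance BanachCategory.instLinear (𝕜 : Type*) [RCLike 𝕜] (C : Type*) [Category C] [BanachHoms C]
    [BanachCategory 𝕜 C] : Linear 𝕜 C where
  homModule _ _ := inferInstance
  smul_comp _ _ _ := BanachCategory.smul_comp
  comp_smul _ _ _ := BanachCategory.comp_smul

/-- The endomorphisms of an object form a complete normed ring, with the norm of `X ⟶ X` and with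
`f * g = g ≫ f`. -/
instance BanachHoms.instNormedRingEnd {C : Type*} [Category C] [BanachHoms C] (X : C) :
    NormedRing (End X) where
  __ := (inferInstance : Ring (End X))
  __ := (BanachHoms.homGroup X X : NormedAddCommGroup (X ⟶ X))
  norm_mul_le f g := by
    have h := BanachHoms.norm_comp_le (C := C) (X := X) (Y := X) (Z := X) g f
    rw [mul_comm] at h
    exact h

instance BanachHoms.instCompleteSpaceEnd {C : Type*} [Category C] [BanachHoms C] (X : C) :
    CompleteSpace (End X) :=
  BanachHoms.homComplete X X

instance BanachCategory.instNormedAlgebraEnd {𝕜 : Type*} [RCLike 𝕜] {C : Type*} [Category C]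
    [BanachHoms C] [BanachCategory 𝕜 C] (X : C) : NormedAlgebra 𝕜 (End X) where
  __ := (inferInstance : Algebra 𝕜 (End X))
  norm_smul_le r f := norm_smul_le (β := (X ⟶ X)) r f

/-- A finite family of contractions `i k : B k ⟶ X` is a coproduct cone, in the sense enriched in
Banach spaces and contractions: composition with the `i k` is an isometric isomorphism from
`X ⟶ Y` onto the product of the `B k ⟶ Y` with the supremum norm, for every `Y`. -/
structure IsBanachCoproduct {C : Type*} [Category C] [BanachHoms C] {ι : Type*} [Fintype ι]
    {B : ι → C} {X : C} (i : ∀ k, B k ⟶ X) : Prop where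
  norm_le : ∀ k, ‖i k‖ ≤ 1
  bijective : ∀ Y : C, Function.Bijective (fun (t : X ⟶ Y) (k : ι) => i k ≫ t)
  isometry : ∀ (Y : C) (t : X ⟶ Y), ‖fun k => i k ≫ t‖ = ‖t‖

/-! ## Cosheaves on a Boolean algebra -/

/-- A precosheaf: a functor on the Boolean algebra `Ω`, seen as a category with one arrow `E ⟶ F`
when `E ≤ F`, whose values on arrows are contractions. -/
structure Precosheaf (Ω : Type*) [BooleanAlgebra Ω] (C : Type*) [Category C] [BanachHoms C] where
  toFunctor : Ω ⥤ C
  norm_map_le : ∀ {E F : Ω} (f : E ⟶ F), ‖toFunctor.map f‖ ≤ 1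

namespace Precosheaf

variable {Ω : Type*} [BooleanAlgebra Ω] {C : Type*} [Category C] [BanachHoms C]

/-- The value `μ(E)`. -/
abbrev obj (μ : Precosheaf Ω C) (E : Ω) : C := μ.toFunctor.obj E

/-- The map `μ(F) ⟶ μ(E)` for `F ≤ E`. -/
abbrev res (μ : Precosheaf Ω C) {F E : Ω} (h : F ≤ E) : μ.obj F ⟶ μ.obj E :=
  μ.toFunctor.map (homOfLE h)

/-- Finite additivity (being a cosheaf for finite partitions): for every finite partition
`E = E₁ ⊔ … ⊔ Eₙ` into pairwise disjoint elements, the maps `μ(Eₖ) ⟶ μ(E)` form a coproduct.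
Families may contain `⊥`, as is needed for `{F, E \ F}` to be a partition for all `F ≤ E`. -/
def IsFinitelyAdditive (μ : Precosheaf Ω C) : Prop :=
  ∀ (n : ℕ) (A : Fin n → Ω) (E : Ω) (hle : ∀ k, A k ≤ E),
    Pairwise (fun j k => Disjoint (A j) (A k)) → Finset.univ.sup A = E →
      IsBanachCoproduct (fun k => μ.res (hle k))

/-- `μ` vanishes at no non-zero element. -/
def IsNondegenerate (μ : Precosheaf Ω C) : Prop :=
  ∀ E : Ω, Limits.IsZero (μ.obj E) → E = ⊥

/-- The diagram that defines the projection `μ(E) ⟶ μ(F)` of a cosheaf, for `F ≤ E`. -/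
def IsProjection (μ : Precosheaf Ω C) {F E : Ω} (h : F ≤ E) (p : μ.obj E ⟶ μ.obj F) : Prop :=
  μ.res h ≫ p = 𝟙 (μ.obj F) ∧ μ.res (sdiff_le : E \ F ≤ E) ≫ p = 0

theorem IsFinitelyAdditive.existsUnique_isProjection {μ : Precosheaf Ω C}
    (hμ : μ.IsFinitelyAdditive) {F E : Ω} (h : F ≤ E) : ∃! p, μ.IsProjection h p := by
  have hle : ∀ k : Fin 2, (![F, E \ F] : Fin 2 → Ω) k ≤ E := by
    intro k; fin_cases k
    · exact h
    · exact sdiff_le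
  have hc := hμ 2 ![F, E \ F] E hle
    (by
      intro j k hjk
      fin_cases j <;> fin_cases k
      · exact absurd rfl hjk
      · exact disjoint_sdiff_self_right
      · exact disjoint_sdiff_self_left
      · exact absurd rfl hjk)
    (by simp [Fin.univ_succ, sup_sdiff_cancel_right h])
  have key := (Function.bijective_iff_existsUnique _).1 (hc.bijective (μ.obj F))
    (fun k => Fin.cases (𝟙 _) (fun j => Fin.cases 0 (fun l => l.elim0) j) k)
  refine (existsUnique_congr fun p => ?_).1 key
  rw [funext_iff, Fin.forall_fin_two]
  exact Iff.rfl

/-- The projection `μ(E) ⟶ μ(F)`, for `F ≤ E`, of a finitely additive cosheaf `μ`: the only arrow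
which is the identity on `μ(F)` and zero on `μ(E \ F)`. -/
noncomputable def proj (μ : Precosheaf Ω C) (hμ : μ.IsFinitelyAdditive) {F E : Ω} (h : F ≤ E) :
    μ.obj E ⟶ μ.obj F :=
  (hμ.existsUnique_isProjection h).choose

theorem proj_spec (μ : Precosheaf Ω C) (hμ : μ.IsFinitelyAdditive) {F E : Ω} (h : F ≤ E) :
    μ.IsProjection h (μ.proj hμ h) :=
  (hμ.existsUnique_isProjection h).choose_spec.1

/-- `P_E`, the composite `μ(⊤) ⟶ μ(E) ⟶ μ(⊤)` of the projection and the map of the cosheaf. -/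
noncomputable def spectralProj (μ : Precosheaf Ω C) (hμ : μ.IsFinitelyAdditive) (E : Ω) :
    End (μ.obj ⊤) :=
  μ.proj hμ (le_top : E ≤ ⊤) ≫ μ.res (le_top : E ≤ ⊤)

end Precosheaf

/-- A spectral measure with values in a ring: additive, multiplicative and unital. -/
structure IsSpectralMeasure {Ω A : Type*} [BooleanAlgebra Ω] [Ring A] (ν : Ω → A) : Prop where
  map_sup : ∀ E F : Ω, Disjoint E F → ν (E ⊔ F) = ν E + ν F
  map_inf : ∀ E F : Ω, ν (E ⊓ F) = ν E * ν F
  map_top : ν ⊤ = 1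

/-! ## The Banach algebra `L∞(Ω)` of a Boolean algebra -/

namespace BoolLinfty

variable (𝕜 : Type*) [RCLike 𝕜] (Ω : Type*) [BooleanAlgebra Ω]

/-- The free vector space on `Ω`, with the multiplication that extends `⊓`. -/
abbrev Free : Type _ := MonoidAlgebra 𝕜 (AsBoolRing Ω)

variable {Ω} in
/-- The basis element of the free vector space at `E`. -/
noncomputable def ι (E : Ω) : Free 𝕜 Ω := MonoidAlgebra.of 𝕜 (AsBoolRing Ω) (toBoolRing E)

/-- The elements `ι(E ⊔ F) - ι(E) - ι(F)` for disjoint `E` and `F`. -/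
def relations : Set (Free 𝕜 Ω) :=
  {x | ∃ E F : Ω, Disjoint E F ∧ x = ι 𝕜 (E ⊔ F) - ι 𝕜 E - ι 𝕜 F}

/-- The ideal generated by the relations. It is also their linear span, by
`relIdeal_eq_span`. -/
noncomputable def relIdeal : Ideal (Free 𝕜 Ω) := Ideal.span (relations 𝕜 Ω)

variable {𝕜 Ω}

theorem ι_mul (E F : Ω) : ι 𝕜 E * ι 𝕜 F = ι 𝕜 (E ⊓ F) := by
  simp only [ι, ← map_mul]; rfl

theorem ι_top : ι 𝕜 (⊤ : Ω) = 1 := map_one (MonoidAlgebra.of 𝕜 (AsBoolRing Ω))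

theorem free_induction {p : Free 𝕜 Ω → Prop} (x : Free 𝕜 Ω) (of : ∀ E, p (ι 𝕜 E))
    (add : ∀ x y, p x → p y → p (x + y)) (smul : ∀ (r : 𝕜) x, p x → p (r • x)) : p x :=
  MonoidAlgebra.induction_on x (fun m => of (ofBoolRing m)) add smul

theorem relIdeal_eq_span :
    (relIdeal 𝕜 Ω).restrictScalars 𝕜 = Submodule.span 𝕜 (relations 𝕜 Ω) := by
  apply le_antisymm
  · intro x hx
    have hx' : x ∈ Ideal.span (relations 𝕜 Ω) := hx
    refine Submodule.span_induction (p := fun x _ => x ∈ Submodule.span 𝕜 (relations 𝕜 Ω))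
      (fun x h => Submodule.subset_span h) (Submodule.zero_mem _)
      (fun _ _ _ _ h h' => Submodule.add_mem _ h h') ?_ hx'
    intro a y _ hy
    rw [smul_eq_mul]
    induction a using free_induction with
    | of G =>
      refine Submodule.span_induction
        (p := fun y _ => ι 𝕜 G * y ∈ Submodule.span 𝕜 (relations 𝕜 Ω)) ?_ ?_ ?_ ?_ hy
      · rintro _ ⟨E, F, hEF, rfl⟩
        refine Submodule.subset_span
          ⟨G ⊓ E, G ⊓ F, hEF.mono inf_le_right inf_le_right, ?_⟩
        rw [mul_sub, mul_sub, ι_mul, ι_mul, ι_mul, inf_sup_left]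
      · rw [mul_zero]; exact Submodule.zero_mem _
      · intro u v _ _ hu hv
        rw [mul_add]; exact Submodule.add_mem _ hu hv
      · intro r u _ hu
        rw [mul_smul_comm]; exact Submodule.smul_mem _ _ hu
    | add u v hu hv => rw [add_mul]; exact Submodule.add_mem _ hu hv
    | smul r u hu => rw [smul_mul_assoc]; exact Submodule.smul_mem _ _ hu
  · rw [Submodule.span_le]
    exact fun x hx => Ideal.subset_span hx

variable (𝕜 Ω)

/-- The algebra of simple elements: the free vector space on `Ω` modulo the relations
`ι(E ⊔ F) = ι(E) + ι(F)` for disjoint `E` and `F`. -/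
def Simple : Type _ := Free 𝕜 Ω ⧸ relIdeal 𝕜 Ω

noncomputable instance : CommRing (Simple 𝕜 Ω) :=
  inferInstanceAs (CommRing (Free 𝕜 Ω ⧸ relIdeal 𝕜 Ω))

noncomputable instance : Algebra 𝕜 (Simple 𝕜 Ω) :=
  inferInstanceAs (Algebra 𝕜 (Free 𝕜 Ω ⧸ relIdeal 𝕜 Ω))

variable {𝕜 Ω}

/-- The quotient map. -/
noncomputable def Simple.mk : Free 𝕜 Ω →ₐ[𝕜] Simple 𝕜 Ω := Ideal.Quotient.mkₐ 𝕜 (relIdeal 𝕜 Ω)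

variable (𝕜)

/-- The characteristic element of `E`. -/
noncomputable def simpleChar (E : Ω) : Simple 𝕜 Ω := Simple.mk (ι 𝕜 E)

variable {𝕜}

theorem simpleChar_sup {E F : Ω} (h : Disjoint E F) :
    simpleChar 𝕜 (E ⊔ F) = simpleChar 𝕜 E + simpleChar 𝕜 F := by
  have : (ι 𝕜 (E ⊔ F) - (ι 𝕜 E + ι 𝕜 F)) ∈ relIdeal 𝕜 Ω :=
    Ideal.subset_span ⟨E, F, h, by abel⟩
  have h2 := Ideal.Quotient.eq.2 this
  rw [map_add] at h2
  exact h2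

theorem simpleChar_inf (E F : Ω) :
    simpleChar 𝕜 (E ⊓ F) = simpleChar 𝕜 E * simpleChar 𝕜 F := by
  have h := congrArg (Ideal.Quotient.mk (relIdeal 𝕜 Ω)) (ι_mul (𝕜 := 𝕜) E F)
  rw [map_mul] at h
  exact h.symm

theorem simpleChar_top : simpleChar 𝕜 (⊤ : Ω) = 1 := by
  have h := congrArg (Ideal.Quotient.mk (relIdeal 𝕜 Ω)) (ι_top (𝕜 := 𝕜) (Ω := Ω))
  rw [map_one] at h
  exact h

theorem simpleChar_bot : simpleChar 𝕜 (⊥ : Ω) = 0 := by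
  have h := simpleChar_sup (𝕜 := 𝕜) (disjoint_bot_left : Disjoint (⊥ : Ω) ⊥)
  rw [sup_idem] at h
  exact left_eq_add.1 h

/-- Every simple element is a linear combination of characteristic elements of the members of a
finite partition. -/
theorem exists_partition (f : Simple 𝕜 Ω) : ∃ (κ : Type) (_ : Fintype κ) (A : κ → Ω) (c : κ → 𝕜),
    Pairwise (fun j k => Disjoint (A j) (A k)) ∧ ∑ k, simpleChar 𝕜 (A k) = 1 ∧
      f = ∑ k, c k • simpleChar 𝕜 (A k) := by
  -- refining a partition by one element
  have step : ∀ (g : Simple 𝕜 Ω) (F : Ω) (r : 𝕜),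
      (∃ (κ : Type) (_ : Fintype κ) (A : κ → Ω) (c : κ → 𝕜),
        Pairwise (fun j k => Disjoint (A j) (A k)) ∧ ∑ k, simpleChar 𝕜 (A k) = 1 ∧
          g = ∑ k, c k • simpleChar 𝕜 (A k)) →
      ∃ (κ : Type) (_ : Fintype κ) (A : κ → Ω) (c : κ → 𝕜),
        Pairwise (fun j k => Disjoint (A j) (A k)) ∧ ∑ k, simpleChar 𝕜 (A k) = 1 ∧
          r • simpleChar 𝕜 F + g = ∑ k, c k • simpleChar 𝕜 (A k) := by
    rintro g F r ⟨κ, hκ, A, c, hA, h1, rfl⟩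
    have hsplit : ∀ k, simpleChar 𝕜 (A k) =
        simpleChar 𝕜 (A k ⊓ F) + simpleChar 𝕜 (A k ⊓ Fᶜ) := by
      intro k
      rw [← simpleChar_sup (disjoint_compl_right.mono inf_le_right inf_le_right),
        ← inf_sup_left, sup_compl_eq_top, inf_top_eq]
    refine ⟨κ × Bool, inferInstance, fun x => A x.1 ⊓ cond x.2 F Fᶜ,
      fun x => c x.1 + cond x.2 r 0, ?_, ?_, ?_⟩
    · rintro ⟨j, b⟩ ⟨k, b'⟩ hne
      by_cases hjk : j = k
      · subst hjk
        cases b <;> cases b'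
        · exact absurd rfl hne
        · exact disjoint_compl_left.mono inf_le_right inf_le_right
        · exact disjoint_compl_right.mono inf_le_right inf_le_right
        · exact absurd rfl hne
      · exact (hA hjk).mono inf_le_left inf_le_left
    · rw [Fintype.sum_prod_type]
      simpa [← hsplit] using h1
    · have hF : simpleChar 𝕜 F = ∑ k, simpleChar 𝕜 (A k ⊓ F) := by
        simp_rw [simpleChar_inf]
        rw [← Finset.sum_mul, h1, one_mul]
      rw [Fintype.sum_prod_type, hF, Finset.smul_sum, ← Finset.sum_add_distrib]
      refine Finset.sum_congr rfl fun k _ => ?_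
      rw [hsplit k]
      simp only [Fintype.sum_bool, cond_true, cond_false, add_smul, smul_add, zero_smul]
      abel
  have add : ∀ (x : Free 𝕜 Ω) (g : Simple 𝕜 Ω) (r : 𝕜),
      (∃ (κ : Type) (_ : Fintype κ) (A : κ → Ω) (c : κ → 𝕜),
        Pairwise (fun j k => Disjoint (A j) (A k)) ∧ ∑ k, simpleChar 𝕜 (A k) = 1 ∧
          g = ∑ k, c k • simpleChar 𝕜 (A k)) →
      ∃ (κ : Type) (_ : Fintype κ) (A : κ → Ω) (c : κ → 𝕜),
        Pairwise (fun j k => Disjoint (A j) (A k)) ∧ ∑ k, simpleChar 𝕜 (A k) = 1 ∧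
          r • Simple.mk x + g = ∑ k, c k • simpleChar 𝕜 (A k) := by
    intro x
    induction x using free_induction with
    | of E => exact fun g r => step g E r
    | add x y hx hy =>
      intro g r hg
      rw [map_add, smul_add, add_assoc]
      exact hx _ _ (hy _ _ hg)
    | smul s x hx =>
      intro g r hg
      rw [map_smul, smul_smul]
      exact hx _ _ hg
  obtain ⟨x, rfl⟩ := Ideal.Quotient.mk_surjective f
  have h := add x 0 1 ⟨Unit, inferInstance, fun _ => ⊤, fun _ => 0,
    fun j k h => absurd rfl h, by simp [simpleChar_top], by simp⟩
  rw [one_smul, add_zero] at h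
  exact h

variable (Ω)

/-- The points of `Ω`: its prime ideals, with the discrete topology. They only serve to define the
supremum norm. -/
def Pt : Type _ := {J : Order.Ideal Ω // J.IsPrime}

instance : TopologicalSpace (Pt Ω) := ⊥

instance : DiscreteTopology (Pt Ω) := ⟨rfl⟩

variable {Ω}

/-- A non-zero element lies outside some prime ideal. -/
theorem exists_pt {E : Ω} (hE : E ≠ ⊥) : ∃ J : Pt Ω, E ∉ J.1 := by
  have hd : Disjoint (Order.PFilter.principal E : Set Ω)
      ((Order.Ideal.principal ⊥ : Order.Ideal Ω) : Set Ω) := by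
    rw [Set.disjoint_left]
    intro x hx hx'
    have h1 : E ≤ x := hx
    have h2 : x ≤ ⊥ := hx'
    exact hE (le_bot_iff.1 (h1.trans h2))
  obtain ⟨J, hJ, -, hdJ⟩ := DistribLattice.prime_ideal_of_disjoint_filter_ideal hd
  exact ⟨⟨J, hJ⟩, fun h => Set.disjoint_left.1 hdJ (show E ≤ E from le_rfl) h⟩

open scoped Classical in
variable (𝕜) in
/-- The indicator function of the set of points of `E`. -/
noncomputable def ind (E : Ω) : BoundedContinuousFunction (Pt Ω) 𝕜 :=
  BoundedContinuousFunction.ofNormedAddCommGroupDiscrete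
    (fun J : Pt Ω => if E ∈ J.1 then (0 : 𝕜) else 1) 1 (fun J => by split_ifs <;> simp)

theorem ind_of_mem {E : Ω} {J : Pt Ω} (h : E ∈ J.1) : ind 𝕜 E J = 0 := if_pos h

theorem ind_of_notMem {E : Ω} {J : Pt Ω} (h : E ∉ J.1) : ind 𝕜 E J = 1 := if_neg h

variable (𝕜 Ω) in
/-- The indicator functions, as a multiplicative map. -/
noncomputable def indHom : AsBoolRing Ω →* BoundedContinuousFunction (Pt Ω) 𝕜 where
  toFun E := ind 𝕜 (ofBoolRing E)
  map_one' := by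
    ext J
    exact ind_of_notMem (fun h => J.2.toIsProper.top_notMem h)
  map_mul' E F := by
    ext J
    rw [ofBoolRing_mul, BoundedContinuousFunction.mul_apply]
    by_cases hE : ofBoolRing E ∈ J.1
    · rw [ind_of_mem hE, ind_of_mem (J.1.lower inf_le_left hE), zero_mul]
    · by_cases hF : ofBoolRing F ∈ J.1
      · rw [ind_of_mem hF, ind_of_mem (J.1.lower inf_le_right hF), mul_zero]
      · rw [ind_of_notMem hE, ind_of_notMem hF, mul_one]
        exact ind_of_notMem fun h => (J.2.mem_or_mem h).elim hE hF

theorem ind_sup {E F : Ω} (h : Disjoint E F) : ind 𝕜 (E ⊔ F) = ind 𝕜 E + ind 𝕜 F := by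
  ext J
  rw [BoundedContinuousFunction.add_apply]
  by_cases hE : E ∈ J.1
  · by_cases hF : F ∈ J.1
    · rw [ind_of_mem hE, ind_of_mem hF, ind_of_mem (Order.Ideal.sup_mem hE hF), add_zero]
    · rw [ind_of_mem hE, ind_of_notMem hF,
        ind_of_notMem fun h' => hF (J.1.lower le_sup_right h'), zero_add]
  · by_cases hF : F ∈ J.1
    · rw [ind_of_notMem hE, ind_of_mem hF,
        ind_of_notMem fun h' => hE (J.1.lower le_sup_left h'), add_zero]
    · have hb : E ⊓ F ∈ J.1 := by rw [h.eq_bot]; exact J.1.bot_mem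
      exact ((J.2.mem_or_mem hb).elim hE hF).elim

variable (𝕜 Ω) in
/-- Simple elements as functions on the points of `Ω`. -/
noncomputable def toFun : Simple 𝕜 Ω →ₐ[𝕜] BoundedContinuousFunction (Pt Ω) 𝕜 :=
  Ideal.Quotient.liftₐ (relIdeal 𝕜 Ω) (MonoidAlgebra.lift 𝕜 _ _ (indHom 𝕜 Ω)) (by
    have h : relIdeal 𝕜 Ω ≤ RingHom.ker (MonoidAlgebra.lift 𝕜 _ _ (indHom 𝕜 Ω)) := by
      refine Ideal.span_le.2 ?_
      rintro _ ⟨E, F, hEF, rfl⟩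
      have hl : ∀ G : Ω, MonoidAlgebra.lift 𝕜 _ _ (indHom 𝕜 Ω) (ι 𝕜 G) = ind 𝕜 G :=
        fun G => MonoidAlgebra.lift_of _ _
      rw [SetLike.mem_coe, RingHom.mem_ker, map_sub, map_sub, hl, hl, hl, ind_sup hEF]
      abel
    exact fun a ha => h ha)

theorem toFun_simpleChar (E : Ω) : toFun 𝕜 Ω (simpleChar 𝕜 E) = ind 𝕜 E :=
  MonoidAlgebra.lift_of (indHom 𝕜 Ω) (toBoolRing E)

theorem toFun_sum_apply {κ : Type*} [Fintype κ] {A : κ → Ω}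
    (hA : Pairwise (fun j k => Disjoint (A j) (A k))) (c : κ → 𝕜) {J : Pt Ω} {k : κ}
    (hk : A k ∉ J.1) : toFun 𝕜 Ω (∑ k, c k • simpleChar 𝕜 (A k)) J = c k := by
  simp only [map_sum, map_smul, toFun_simpleChar, BoundedContinuousFunction.coe_sum,
    Finset.sum_apply, BoundedContinuousFunction.coe_smul]
  rw [Finset.sum_eq_single k]
  · rw [ind_of_notMem hk, smul_eq_mul, mul_one]
  · intro j _ hj
    have hb : A j ⊓ A k ∈ J.1 := by rw [(hA hj).eq_bot]; exact J.1.bot_mem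
    rw [ind_of_mem ((J.2.mem_or_mem hb).resolve_right hk), smul_zero]
  · exact fun h => absurd (Finset.mem_univ k) h

theorem toFun_injective : Function.Injective (toFun 𝕜 Ω) := by
  rw [injective_iff_map_eq_zero]
  intro f hf
  obtain ⟨κ, hκ, A, c, hA, -, rfl⟩ := exists_partition f
  refine Finset.sum_eq_zero fun k _ => ?_
  by_cases hk : A k = ⊥
  · rw [hk, simpleChar_bot, smul_zero]
  · obtain ⟨J, hJ⟩ := exists_pt hk
    have h := toFun_sum_apply hA c hJ
    rw [hf] at h
    rw [← h]
    exact zero_smul 𝕜 _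

/-- The norm of a simple element is its supremum norm as a function on the points of `Ω`; by
`norm_sum` this is `max |c k|` for a combination `∑ c k • χ(A k)` with non-zero and pairwise
disjoint `A k`. -/
noncomputable instance : NormedCommRing (Simple 𝕜 Ω) :=
  NormedCommRing.induced _ _ (toFun 𝕜 Ω) toFun_injective

noncomputable instance : NormedAlgebra 𝕜 (Simple 𝕜 Ω) where
  __ := (inferInstance : Algebra 𝕜 (Simple 𝕜 Ω))
  norm_smul_le r f := by
    change ‖toFun 𝕜 Ω (r • f)‖ ≤ ‖r‖ * ‖toFun 𝕜 Ω f‖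
    rw [map_smul]
    exact norm_smul_le _ _

theorem norm_sum {κ : Type*} [Fintype κ] {A : κ → Ω}
    (hA : Pairwise (fun j k => Disjoint (A j) (A k))) (hne : ∀ k, A k ≠ ⊥) (c : κ → 𝕜) :
    ‖∑ k, c k • simpleChar 𝕜 (A k)‖ = ‖c‖ := by
  change ‖toFun 𝕜 Ω (∑ k, c k • simpleChar 𝕜 (A k))‖ = ‖c‖
  apply le_antisymm
  · rw [BoundedContinuousFunction.norm_le (norm_nonneg _)]
    intro J
    by_cases h : ∃ k, A k ∉ J.1
    · obtain ⟨k, hk⟩ := h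
      rw [toFun_sum_apply hA c hk]
      exact norm_le_pi_norm c k
    · push Not at h
      have : toFun 𝕜 Ω (∑ k, c k • simpleChar 𝕜 (A k)) J = 0 := by
        simp only [map_sum, map_smul, toFun_simpleChar, BoundedContinuousFunction.coe_sum,
          Finset.sum_apply, BoundedContinuousFunction.coe_smul]
        exact Finset.sum_eq_zero fun k _ => by rw [ind_of_mem (h k), smul_zero]
      rw [this, norm_zero]
      exact norm_nonneg _
  · rw [pi_norm_le_iff_of_nonneg (norm_nonneg _)]
    intro k
    obtain ⟨J, hJ⟩ := exists_pt (hne k)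
    rw [← toFun_sum_apply hA c hJ]
    exact BoundedContinuousFunction.norm_coe_le_norm _ J

end BoolLinfty

/-- The Banach algebra `L∞(Ω)`: the completion of the simple elements for the supremum norm. -/
abbrev BoolLinfty (𝕜 : Type*) [RCLike 𝕜] (Ω : Type*) [BooleanAlgebra Ω] : Type _ :=
  UniformSpace.Completion (BoolLinfty.Simple 𝕜 Ω)

/-- The characteristic element of `E` in `L∞(Ω)`. -/
noncomputable def BoolLinfty.char (𝕜 : Type*) [RCLike 𝕜] {Ω : Type*} [BooleanAlgebra Ω] (E : Ω) :
    BoolLinfty 𝕜 Ω :=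
  (BoolLinfty.simpleChar 𝕜 E : UniformSpace.Completion (BoolLinfty.Simple 𝕜 Ω))

/-!
Write `P_E` for `μ.spectralProj hμ E`. For `F ≤ E` the composite `μ(F) ⟶ μ(⊤) ⟶ μ(⊤)` with `P_E` is
the structure map `μ(F) ⟶ μ(⊤)`, and for `F` disjoint from `E` it is zero. Since `μ(⊤)` is the
coproduct of the `μ(Aₖ)` for every finite partition `(Aₖ)` of `⊤`, the norm of an endomorphism of
`μ(⊤)` is the maximum of the norms of its restrictions to the `μ(Aₖ)`
(`Precosheaf.norm_le_of_partition`). This one fact carries most of the theorem: with norm zero it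
says that endomorphisms agreeing on each `μ(Aₖ)` are equal, which gives the identities of a
spectral measure, and it gives `‖∑ cₖ P_{Aₖ}‖ ≤ max |cₖ|`, because that endomorphism restricts to
`cₖ` times a contraction on `μ(Aₖ)`.

A spectral measure with values in an algebra is the same as a unital morphism out of the algebra of
simple elements (`IsSpectralMeasure.lift`). The inequality says that the morphism of `P` is a
contraction, so it extends to the completion `L∞(Ω)`, uniquely by density.

A spectral measure `ν` satisfies `ν(Aₖ) ∑ cⱼ ν(Aⱼ) = cₖ ν(Aₖ)` on a partition, so
`max |cₖ| ≤ ‖∑ cₖ ν(Aₖ)‖` as soon as no `ν(Aₖ)` vanishes (`IsSpectralMeasure.norm_le_norm_lift`).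
Finally `P_E = 0` exactly when `μ(E)` is a zero object, as `P_E` factors through `μ(E)` and the
identity of `μ(E)` factors through `P_E`. Hence the morphism is isometric when `μ` is
non-degenerate; and if `μ(E)` is a zero object for some `E ≠ ⊥`, then it kills `χ(E)`, which has
norm one.
-/

/-! ### Simple elements -/

namespace BoolLinfty

variable {𝕜 : Type*} [RCLike 𝕜] {Ω : Type*} [BooleanAlgebra Ω]

theorem simpleChar_finset_sup {κ : Type*} {A : κ → Ω}
    (hA : Pairwise (fun j k => Disjoint (A j) (A k))) (s : Finset κ) :
    simpleChar 𝕜 (s.sup A) = ∑ k ∈ s, simpleChar 𝕜 (A k) := by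
  classical
  induction s using Finset.induction_on with
  | empty => simp [simpleChar_bot]
  | insert a s ha ih =>
    rw [Finset.sup_insert, simpleChar_sup, ih, Finset.sum_insert ha]
    exact Finset.disjoint_sup_right.2 fun k hk => hA fun h => ha (h ▸ hk)

theorem norm_simpleChar {E : Ω} (hE : E ≠ ⊥) : ‖simpleChar 𝕜 E‖ = 1 := by
  have h := norm_sum (𝕜 := 𝕜) (κ := Unit) (A := fun _ => E)
    (fun j k hjk => absurd (Subsingleton.elim j k) hjk) (fun _ => hE) (fun _ => 1)
  simpa using h

theorem simpleChar_eq_zero_iff {E : Ω} : simpleChar 𝕜 E = 0 ↔ E = ⊥ := by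
  refine ⟨fun h => ?_, fun h => h ▸ simpleChar_bot⟩
  by_contra hE
  have h1 := norm_simpleChar (𝕜 := 𝕜) hE
  rw [h, norm_zero] at h1
  exact zero_ne_one h1

/-- A refinement of `exists_partition`: the members of the partition may be taken non-zero, and
they have supremum `⊤`. -/
theorem exists_partition_ne_bot (f : Simple 𝕜 Ω) :
    ∃ (κ : Type) (_ : Fintype κ) (A : κ → Ω) (c : κ → 𝕜),
      Pairwise (fun j k => Disjoint (A j) (A k)) ∧ (∀ k, A k ≠ ⊥) ∧ Finset.univ.sup A = ⊤ ∧
        f = ∑ k, c k • simpleChar 𝕜 (A k) := by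
  classical
  obtain ⟨κ, hκ, A, c, hA, h1, rfl⟩ := exists_partition f
  have hzero : ∀ k, ¬ A k ≠ ⊥ → simpleChar 𝕜 (A k) = 0 := fun k hk => by
    rw [not_not.1 hk, simpleChar_bot]
  have hsum : ∀ g : κ → Simple 𝕜 Ω, (∀ k, ¬ A k ≠ ⊥ → g k = 0) →
      ∑ k : {k // A k ≠ ⊥}, g k = ∑ k, g k := fun g hg => by
    rw [← Finset.sum_subtype (Finset.univ.filter fun k => A k ≠ ⊥) (by simp) g]
    exact Finset.sum_filter_of_ne fun k _ hk => by_contra fun h => hk (hg k h)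
  have hA' : Pairwise fun j k : {k // A k ≠ ⊥} => Disjoint (A j) (A k) :=
    fun j k hjk => hA fun h => hjk (Subtype.ext h)
  refine ⟨{k // A k ≠ ⊥}, inferInstance, fun k => A k, fun k => c k, hA', fun k => k.2, ?_, ?_⟩
  · -- the complement of the supremum has characteristic element `1 - 1 = 0`
    rw [← compl_eq_bot, ← simpleChar_eq_zero_iff (𝕜 := 𝕜)]
    have h := simpleChar_sup (𝕜 := 𝕜)
      (disjoint_compl_right (a := Finset.univ.sup fun k : {k // A k ≠ ⊥} => A k))
    rw [sup_compl_eq_top, simpleChar_top, simpleChar_finset_sup hA',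
      hsum (fun k => simpleChar 𝕜 (A k)) hzero, h1] at h
    exact left_eq_add.1 h
  · exact (hsum (fun k => c k • simpleChar 𝕜 (A k)) fun k hk => by rw [hzero k hk, smul_zero]).symm

end BoolLinfty

/-! ### Spectral measures as morphisms on simple elements -/

namespace IsSpectralMeasure

open BoolLinfty

variable {Ω A : Type*} [BooleanAlgebra Ω]

theorem map_bot [Ring A] {ν : Ω → A} (hν : IsSpectralMeasure ν) : ν ⊥ = 0 := by
  have h := hν.map_sup ⊥ ⊥ disjoint_bot_left
  rw [sup_idem] at h
  exact left_eq_add.1 h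

variable {𝕜 : Type*} [RCLike 𝕜]

variable (𝕜) in
/-- The morphism on simple elements that extends a spectral measure `ν`. -/
noncomputable def lift [Ring A] [Algebra 𝕜 A] {ν : Ω → A} (hν : IsSpectralMeasure ν) :
    Simple 𝕜 Ω →ₐ[𝕜] A :=
  let φ : AsBoolRing Ω →* A :=
    { toFun := fun E => ν (ofBoolRing E)
      map_one' := hν.map_top
      map_mul' := fun E F => hν.map_inf (ofBoolRing E) (ofBoolRing F) }
  Ideal.Quotient.liftₐ (relIdeal 𝕜 Ω) (MonoidAlgebra.lift 𝕜 A (AsBoolRing Ω) φ) (by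
    have h : relIdeal 𝕜 Ω ≤ RingHom.ker (MonoidAlgebra.lift 𝕜 A (AsBoolRing Ω) φ) := by
      refine Ideal.span_le.2 ?_
      rintro _ ⟨E, F, hEF, rfl⟩
      have hl : ∀ G : Ω, MonoidAlgebra.lift 𝕜 A (AsBoolRing Ω) φ (ι 𝕜 G) = ν G :=
        fun G => MonoidAlgebra.lift_of _ _
      rw [SetLike.mem_coe, RingHom.mem_ker, map_sub, map_sub, hl, hl, hl, hν.map_sup E F hEF]
      abel
    exact fun a ha => h ha)

theorem lift_simpleChar [Ring A] [Algebra 𝕜 A] {ν : Ω → A} (hν : IsSpectralMeasure ν) (E : Ω) :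
    hν.lift 𝕜 (simpleChar 𝕜 E) = ν E :=
  MonoidAlgebra.lift_of _ (toBoolRing E)

theorem lift_sum [Ring A] [Algebra 𝕜 A] {ν : Ω → A} (hν : IsSpectralMeasure ν)
    {κ : Type*} [Fintype κ] (B : κ → Ω) (c : κ → 𝕜) :
    hν.lift 𝕜 (∑ k, c k • simpleChar 𝕜 (B k)) = ∑ k, c k • ν (B k) := by
  simp only [map_sum, map_smul, lift_simpleChar]

/-- On a partition into non-zero elements, multiplication by `ν(Bₖ)` isolates the coefficient
`cₖ` of `∑ cⱼ ν(Bⱼ)`, and `‖ν(Bₖ)‖` cancels. -/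
theorem norm_le_norm_lift [NormedRing A] [NormedAlgebra 𝕜 A] {ν : Ω → A}
    (hν : IsSpectralMeasure ν) (hne : ∀ E, ν E = 0 → E = ⊥) (f : Simple 𝕜 Ω) :
    ‖f‖ ≤ ‖hν.lift 𝕜 f‖ := by
  obtain ⟨κ, _, B, c, hB, hB0, -, rfl⟩ := exists_partition_ne_bot f
  rw [norm_sum hB hB0, hν.lift_sum, pi_norm_le_iff_of_nonneg (norm_nonneg _)]
  intro k
  have hk : ν (B k) * ∑ j, c j • ν (B j) = c k • ν (B k) := by
    rw [Finset.mul_sum, Finset.sum_eq_single k]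
    · rw [mul_smul_comm, ← hν.map_inf, inf_idem]
    · intro j _ hj
      rw [mul_smul_comm, ← hν.map_inf, (hB hj.symm).eq_bot, hν.map_bot, smul_zero]
    · exact fun h => absurd (Finset.mem_univ k) h
  have hpos : 0 < ‖ν (B k)‖ := norm_pos_iff.2 fun h => hB0 k (hne _ h)
  refine le_of_mul_le_mul_left ?_ hpos
  calc ‖ν (B k)‖ * ‖c k‖ = ‖c k • ν (B k)‖ := by rw [norm_smul, mul_comm]
    _ ≤ _ := by rw [← hk]; exact norm_mul_le _ _

end IsSpectralMeasure

/-! ### Extension to `L∞(Ω)` -/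

namespace BoolLinfty

variable {𝕜 : Type*} [RCLike 𝕜] {Ω : Type*} [BooleanAlgebra Ω] {A : Type*} [NormedRing A]
  [NormedAlgebra 𝕜 A]

theorem continuous_of_norm_le (φ : Simple 𝕜 Ω →ₐ[𝕜] A) (hφ : ∀ f, ‖φ f‖ ≤ ‖f‖) :
    Continuous (φ : Simple 𝕜 Ω →+* A) :=
  AddMonoidHomClass.continuous_of_bound φ 1 fun f => by rw [one_mul]; exact hφ f

/-- The extension to `L∞(Ω)` of a contractive morphism on simple elements. -/
noncomputable def extend [CompleteSpace A] (φ : Simple 𝕜 Ω →ₐ[𝕜] A) (hφ : ∀ f, ‖φ f‖ ≤ ‖f‖) :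
    BoolLinfty 𝕜 Ω →A[𝕜] A :=
  have hc : Continuous (φ : Simple 𝕜 Ω →+* A) := continuous_of_norm_le φ hφ
  { UniformSpace.Completion.extensionHom (φ : Simple 𝕜 Ω →+* A) hc with
    commutes' := fun r => by
      change UniformSpace.Completion.extensionHom (φ : Simple 𝕜 Ω →+* A) hc _ = _
      rw [UniformSpace.Completion.algebraMap_def, UniformSpace.Completion.extensionHom_coe]
      exact φ.commutes r
    cont := UniformSpace.Completion.continuous_extension }

theorem extend_coe [CompleteSpace A] (φ : Simple 𝕜 Ω →ₐ[𝕜] A) (hφ : ∀ f, ‖φ f‖ ≤ ‖f‖)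
    (f : Simple 𝕜 Ω) : extend φ hφ (f : BoolLinfty 𝕜 Ω) = φ f :=
  UniformSpace.Completion.extensionHom_coe (φ : Simple 𝕜 Ω →+* A)
    (continuous_of_norm_le φ hφ) f

theorem norm_extend_le [CompleteSpace A] (φ : Simple 𝕜 Ω →ₐ[𝕜] A) (hφ : ∀ f, ‖φ f‖ ≤ ‖f‖)
    (f : BoolLinfty 𝕜 Ω) : ‖extend φ hφ f‖ ≤ ‖f‖ := by
  induction f using UniformSpace.Completion.induction_on with
  | hp => exact isClosed_le (extend φ hφ).continuous.norm continuous_norm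
  | ih f =>
    rw [extend_coe, UniformSpace.Completion.norm_coe]
    exact hφ f

theorem isometry_extend [CompleteSpace A] (φ : Simple 𝕜 Ω →ₐ[𝕜] A) (hφ : ∀ f, ‖φ f‖ ≤ ‖f‖)
    (hφ' : ∀ f, ‖f‖ ≤ ‖φ f‖) : Isometry (extend φ hφ) := by
  refine AddMonoidHomClass.isometry_of_norm _ fun f => ?_
  induction f using UniformSpace.Completion.induction_on with
  | hp => exact isClosed_eq (extend φ hφ).continuous.norm continuous_norm
  | ih f =>
    rw [extend_coe, UniformSpace.Completion.norm_coe]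
    exact (hφ f).antisymm (hφ' f)

/-- Continuous morphisms on `L∞(Ω)` are determined by the characteristic elements, which span a
dense subspace. -/
theorem ext_char {Φ Ψ : BoolLinfty 𝕜 Ω →A[𝕜] A} (h : ∀ E : Ω, Ψ (char 𝕜 E) = Φ (char 𝕜 E)) :
    Ψ = Φ := by
  ext f
  induction f using UniformSpace.Completion.induction_on with
  | hp => exact isClosed_eq Ψ.continuous Φ.continuous
  | ih f =>
    obtain ⟨κ, _, B, c, -, -, rfl⟩ := exists_partition f
    have hcoe : ((∑ k, c k • simpleChar 𝕜 (B k) : Simple 𝕜 Ω) : BoolLinfty 𝕜 Ω) =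
        ∑ k, c k • char 𝕜 (B k) := by
      let T := UniformSpace.Completion.toComplₗᵢ (𝕜 := 𝕜) (E := Simple 𝕜 Ω)
      exact (map_sum T _ _).trans (Finset.sum_congr rfl fun k _ => T.map_smul (c k) _)
    rw [hcoe]
    simp only [map_sum, map_smul, h]

theorem norm_char {E : Ω} (hE : E ≠ ⊥) : ‖char 𝕜 E‖ = 1 :=
  (UniformSpace.Completion.norm_coe _).trans (norm_simpleChar hE)

end BoolLinfty

/-! ### The spectral measure of a cosheaf -/

namespace Precosheaf

variable {Ω : Type*} [BooleanAlgebra Ω] {C : Type*} [Category C] [BanachHoms C]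
  {μ : Precosheaf Ω C}

theorem res_comp_res (μ : Precosheaf Ω C) {E F G : Ω} (h : E ≤ F) (h' : F ≤ G) :
    μ.res h ≫ μ.res h' = μ.res (h.trans h') :=
  (μ.toFunctor.map_comp _ _).symm

/-- The norm of an arrow out of `μ(⊤)` is determined on any finite partition of `⊤`. -/
theorem norm_le_of_partition (hμ : μ.IsFinitelyAdditive) {κ : Type*} [Fintype κ] {A : κ → Ω}
    (hA : Pairwise (fun j k => Disjoint (A j) (A k))) (htop : Finset.univ.sup A = ⊤) {Y : C}
    (t : μ.obj ⊤ ⟶ Y) {r : ℝ} (hr : 0 ≤ r)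
    (h : ∀ k, ‖μ.res (le_top : A k ≤ ⊤) ≫ t‖ ≤ r) : ‖t‖ ≤ r := by
  let e := (Fintype.equivFin κ).symm
  have hc := hμ _ (A ∘ e) ⊤ (fun _ => le_top) (fun j k hjk => hA (e.injective.ne hjk)) (by
    rw [← htop, ← Finset.univ_map_equiv_to_embedding e, Finset.sup_map]
    rfl)
  rw [← hc.isometry Y t, pi_norm_le_iff_of_nonneg hr]
  exact fun k => h (e k)

/-- `norm_le_of_partition` for the partition of `⊤` into `E` and its complement. -/
theorem norm_le_of_compl (hμ : μ.IsFinitelyAdditive) (E : Ω) {Y : C} (t : μ.obj ⊤ ⟶ Y) {r : ℝ}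
    (hr : 0 ≤ r) (h₁ : ‖μ.res (le_top : E ≤ ⊤) ≫ t‖ ≤ r)
    (h₂ : ‖μ.res (le_top : Eᶜ ≤ ⊤) ≫ t‖ ≤ r) : ‖t‖ ≤ r := by
  refine norm_le_of_partition hμ (A := fun b => cond b E Eᶜ) ?_ (by simp) t hr ?_
  · rintro (_ | _) (_ | _) h
    · exact absurd rfl h
    · exact disjoint_compl_left
    · exact disjoint_compl_right
    · exact absurd rfl h
  · rintro (_ | _)
    · exact h₂
    · exact h₁

/-- Two arrows out of `μ(⊤)` are equal if they agree on each of the four pieces into which `E` and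
`F` divide `⊤`. It suffices to know that they agree on any `G` which lies below or is disjoint from
`E`, and likewise for `F`. -/
theorem hom_ext_of_pieces (hμ : μ.IsFinitelyAdditive) (E F : Ω) {Y : C} {s t : μ.obj ⊤ ⟶ Y}
    (h : ∀ G : Ω, (G ≤ E ∨ Disjoint G E) → (G ≤ F ∨ Disjoint G F) →
      μ.res (le_top : G ≤ ⊤) ≫ s = μ.res (le_top : G ≤ ⊤) ≫ t) : s = t := by
  rw [← sub_eq_zero, ← norm_le_zero_iff]
  refine norm_le_of_partition hμ
    (A := fun b : Bool × Bool => cond b.1 E Eᶜ ⊓ cond b.2 F Fᶜ) ?_ ?_ (s - t) le_rfl ?_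
  · rintro ⟨_ | _, _ | _⟩ ⟨_ | _, _ | _⟩ hne <;>
    first
    | exact absurd rfl hne
    | exact disjoint_compl_left.mono inf_le_left inf_le_left
    | exact disjoint_compl_right.mono inf_le_left inf_le_left
    | exact disjoint_compl_left.mono inf_le_right inf_le_right
    | exact disjoint_compl_right.mono inf_le_right inf_le_right
  · rw [← Finset.univ_product_univ, Finset.sup_product_left]
    simp [← inf_sup_left]
  · have hpiece : ∀ (b : Bool) (E G : Ω), G ≤ cond b E Eᶜ → G ≤ E ∨ Disjoint G E := by
      rintro (_ | _) E G hG
      · exact Or.inr (le_compl_iff_disjoint_right.1 hG)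
      · exact Or.inl hG
    intro b
    rw [Preadditive.comp_sub, h _ (hpiece b.1 E _ inf_le_left) (hpiece b.2 F _ inf_le_right),
      sub_self, norm_zero]

theorem res_comp_spectralProj_of_le (hμ : μ.IsFinitelyAdditive) {E F : Ω} (h : F ≤ E) :
    μ.res (le_top : F ≤ ⊤) ≫ μ.spectralProj hμ E = μ.res (le_top : F ≤ ⊤) := by
  rw [← res_comp_res μ h le_top, Category.assoc]
  unfold spectralProj
  rw [← Category.assoc (μ.res (le_top : E ≤ ⊤)), (μ.proj_spec hμ le_top).1, Category.id_comp]

theorem res_comp_spectralProj_of_disjoint (hμ : μ.IsFinitelyAdditive) {E F : Ω}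
    (h : Disjoint F E) : μ.res (le_top : F ≤ ⊤) ≫ μ.spectralProj hμ E = 0 := by
  have h' : F ≤ ⊤ \ E := le_sdiff.2 ⟨le_top, h⟩
  rw [← res_comp_res μ h' sdiff_le, Category.assoc]
  unfold spectralProj
  rw [← Category.assoc (μ.res sdiff_le), (μ.proj_spec hμ le_top).2, Limits.zero_comp,
    Limits.comp_zero]

theorem isSpectralMeasure_spectralProj (hμ : μ.IsFinitelyAdditive) :
    IsSpectralMeasure (μ.spectralProj hμ) where
  map_sup E F hEF := by
    refine hom_ext_of_pieces hμ E F fun G hE hF => ?_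
    refine Eq.trans ?_ (Preadditive.comp_add _ _ _ _ _ _).symm
    rcases hE with hE | hE
    · rw [res_comp_spectralProj_of_le hμ (hE.trans le_sup_left),
        res_comp_spectralProj_of_le hμ hE,
        res_comp_spectralProj_of_disjoint hμ (hEF.mono_left hE), add_zero]
    · rcases hF with hF | hF
      · rw [res_comp_spectralProj_of_le hμ (hF.trans le_sup_right),
          res_comp_spectralProj_of_disjoint hμ hE, res_comp_spectralProj_of_le hμ hF, zero_add]
      · rw [res_comp_spectralProj_of_disjoint hμ (hE.sup_right hF),
          res_comp_spectralProj_of_disjoint hμ hE, res_comp_spectralProj_of_disjoint hμ hF,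
          add_zero]
  map_inf E F := by
    refine hom_ext_of_pieces hμ E F fun G hE hF => ?_
    -- multiplication of endomorphisms is composition in the reverse order
    change _ = μ.res _ ≫ μ.spectralProj hμ F ≫ μ.spectralProj hμ E
    rw [← Category.assoc]
    rcases hF with hF | hF
    · rw [res_comp_spectralProj_of_le hμ hF]
      rcases hE with hE | hE
      · rw [res_comp_spectralProj_of_le hμ (le_inf hE hF), res_comp_spectralProj_of_le hμ hE]
      · rw [res_comp_spectralProj_of_disjoint hμ (hE.mono_right inf_le_left),
          res_comp_spectralProj_of_disjoint hμ hE]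
    · rw [res_comp_spectralProj_of_disjoint hμ hF,
        res_comp_spectralProj_of_disjoint hμ (hF.mono_right inf_le_right), Limits.zero_comp]
  map_top := by
    refine hom_ext_of_pieces hμ ⊤ ⊤ fun G _ _ => ?_
    rw [res_comp_spectralProj_of_le hμ le_top]
    exact (Category.comp_id _).symm

theorem norm_spectralProj_le (hμ : μ.IsFinitelyAdditive) (E : Ω) :
    ‖μ.spectralProj hμ E‖ ≤ 1 := by
  refine norm_le_of_compl hμ E (μ.spectralProj hμ E) zero_le_one ?_ ?_
  · rw [res_comp_spectralProj_of_le hμ le_rfl]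
    exact μ.norm_map_le _
  · rw [res_comp_spectralProj_of_disjoint hμ disjoint_compl_left, norm_zero]
    exact zero_le_one

/-- On `μ(Aₖ)` the endomorphism `∑ cⱼ P_{Aⱼ}` is `cₖ` times the structure map, a contraction. -/
theorem norm_lift_spectralProj_le {𝕜 : Type*} [RCLike 𝕜] [BanachCategory 𝕜 C]
    (hμ : μ.IsFinitelyAdditive) (f : BoolLinfty.Simple 𝕜 Ω) :
    ‖(isSpectralMeasure_spectralProj hμ).lift 𝕜 f‖ ≤ ‖f‖ := by
  obtain ⟨κ, _, A, c, hA, hA0, htop, rfl⟩ := BoolLinfty.exists_partition_ne_bot f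
  rw [BoolLinfty.norm_sum hA hA0, IsSpectralMeasure.lift_sum]
  refine norm_le_of_partition hμ hA htop (∑ k, c k • μ.spectralProj hμ (A k) : μ.obj ⊤ ⟶ μ.obj ⊤)
    (norm_nonneg _) fun k => ?_
  have hk : μ.res (le_top : A k ≤ ⊤) ≫ (∑ j, c j • μ.spectralProj hμ (A j) : μ.obj ⊤ ⟶ μ.obj ⊤) =
      c k • μ.res (le_top : A k ≤ ⊤) := by
    rw [Preadditive.comp_sum, Finset.sum_eq_single k]
    · rw [BanachCategory.comp_smul, res_comp_spectralProj_of_le hμ le_rfl]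
    · intro j _ hj
      rw [BanachCategory.comp_smul, res_comp_spectralProj_of_disjoint hμ (hA hj.symm), smul_zero]
    · exact fun h => absurd (Finset.mem_univ k) h
  rw [hk, norm_smul]
  exact (mul_le_of_le_one_right (norm_nonneg _) (μ.norm_map_le _)).trans (norm_le_pi_norm c k)

theorem spectralProj_eq_zero_iff (hμ : μ.IsFinitelyAdditive) (E : Ω) :
    μ.spectralProj hμ E = 0 ↔ Limits.IsZero (μ.obj E) := by
  refine ⟨fun h => ?_, fun h => ?_⟩
  · rw [Limits.IsZero.iff_id_eq_zero, ← (μ.proj_spec hμ (le_top : E ≤ ⊤)).1,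
      ← res_comp_spectralProj_of_le hμ le_rfl, h]
    exact (congrArg (· ≫ _) Limits.comp_zero).trans Limits.zero_comp
  · unfold spectralProj
    rw [h.eq_of_src (μ.res (le_top : E ≤ ⊤)) 0]
    exact Limits.comp_zero

end Precosheaf

theorem mainTheorem4 {𝕜 : Type*} [RCLike 𝕜] {Ω : Type*} [BooleanAlgebra Ω]
    {C : Type*} [Category C] [BanachHoms C] [BanachCategory 𝕜 C]
    (μ : Precosheaf Ω C) (hμ : μ.IsFinitelyAdditive) :
    IsSpectralMeasure (μ.spectralProj hμ) ∧
    (∀ E : Ω, ‖μ.spectralProj hμ E‖ ≤ 1) ∧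
    ∃ Φ : BoolLinfty 𝕜 Ω →A[𝕜] End (μ.obj ⊤),
      (∀ E : Ω, Φ (BoolLinfty.char 𝕜 E) = μ.spectralProj hμ E) ∧
      (∀ Ψ : BoolLinfty 𝕜 Ω →A[𝕜] End (μ.obj ⊤),
        (∀ E : Ω, Ψ (BoolLinfty.char 𝕜 E) = μ.spectralProj hμ E) → Ψ = Φ) ∧
      (∀ f : BoolLinfty 𝕜 Ω, ‖Φ f‖ ≤ ‖f‖) ∧
      (Isometry Φ ↔ μ.IsNondegenerate) := by
  have hν := Precosheaf.isSpectralMeasure_spectralProj hμ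
  have hle : ∀ f, ‖hν.lift 𝕜 f‖ ≤ ‖f‖ := Precosheaf.norm_lift_spectralProj_le hμ
  have hchar : ∀ E : Ω, BoolLinfty.extend (hν.lift 𝕜) hle (BoolLinfty.char 𝕜 E) =
      μ.spectralProj hμ E := fun E =>
    (BoolLinfty.extend_coe _ hle _).trans (hν.lift_simpleChar E)
  refine ⟨hν, Precosheaf.norm_spectralProj_le hμ, BoolLinfty.extend (hν.lift 𝕜) hle, hchar,
    fun Ψ hΨ => BoolLinfty.ext_char fun E => (hΨ E).trans (hchar E).symm,
    BoolLinfty.norm_extend_le _ hle, fun hiso E hE => ?_, fun hnd => ?_⟩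
  · by_contra hne
    have h : ‖BoolLinfty.char 𝕜 E‖ = 0 := by
      rw [← hiso.norm_map_of_map_zero (map_zero _), hchar,
        (Precosheaf.spectralProj_eq_zero_iff hμ E).2 hE, norm_zero]
    rw [BoolLinfty.norm_char hne] at h
    exact one_ne_zero h
  · exact BoolLinfty.isometry_extend _ hle (hν.norm_le_norm_lift fun E hE =>
      hnd E ((Precosheaf.spectralProj_eq_zero_iff hμ E).1 hE))
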